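/- Let $\mathbb H$ be the quaternions and let $V$ be a bilateral quaternionic Banach space: a complete normed group with commuting left and right $\mathbb H$-multiplications that agree on $\mathbb R$ and satisfy $\|qv\|\le|q|\|v\|$, $\|vq\|\le|q|\|v\|$. Let $\mathcal B(V)$ be the space of bounded right linear operators on $V$ with the operator norm, let $\mathcal I$ be the identity, and put $(qT)(v)=q\,T(v)$, $(Tq)(v)=T(qv)$ for $T\in\mathcal B(V)$, $q\in\mathbb H$. For $T\in\mathcal B(V)$ let $$\sigma_S(T)=\{s\in\mathbb H:\ T^2-2\,\mathrm{Re}[s]\,T+|s|^2\mathcal I\ \text{ is not invertible in }\mathcal B(V)\},$$ and for $s\notin\sigma_S(T)$ let $$S^{-1}(s,T)=-(T^2-2\,\mathrm{Re}[s]\,T+|s|^2\mathcal I)^{-1}(T-\overline s\,\mathcal I).$$ Let $I\in\mathbb H$ satisfy $\mathrm{Re}[I]=0$ and $|I|=1$, and let $L_I=\mathbb R+I\mathbb R$, identified with $\mathbb C$ by $x+Iy\leftrightarrow x+iy$. Let $U\subset L_I$ be bounded, open in $L_I$, with $L_I\cap\sigma_S(T)\subset U$, and suppose that its boundary $\partial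 U$ in $L_I$ is positively oriented by finitely many closed rectifiable curves $\gamma_1,\dots,\gamma_n$ in $L_I$, parametrized on $[0,1]$ by Lipschitz maps. That is, the union of their images is $\partial U$, and the sum of their winding numbers is $1$ about each point of $U$ and $0$ about each point of $L_I\setminus\overline U$. For $f:\mathbb H\to\mathbb H$ write $$\int_{\partial U}S^{-1}(s,T)\,ds_I\,f(s)=\sum_{k=1}^n\int_0^1 S^{-1}(\gamma_k(t),T)\,\bigl(-I\,\gamma_k'(t)\bigr)\,f(\gamma_k(t))\,dt ,\qquad ds_I=-I\,ds,$$ with integrals taken in $\mathcal B(V)$. Then for every $m\in\mathbb N\cup\{0\}$ and $a\in\mathbb H$ the integrands for $f(s)=s^ma$ are integrable and $$T^m a=\frac1{2\pi}\int_{\partial U}S^{-1}(s,T)\,ds_I\,s^m\,a .$$ Consequently the $S$-functional calculus agrees with polynomial evaluation: for all $N\ge0$ and $a_0,\dots,a_N\in\mathbb H$ the integrands for $f(s)=\sum_{m=0}^N s^ma_m$ are integrable and $$\sum_{m=0}^N T^m a_m=\frac1{2\pi}\int_{\partial U}S^{-1}(s,T)\,ds_I\,\sum_{m=0}^N s^m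 a_m .$$ -/

import Mathlib

open scoped Quaternion

noncomputable section

namespace QuatFC

section Operators

/- `V` is a bilateral quaternionic Banach space: a complete normed group with commuting left and
right multiplications by quaternions, each bounded by the modulus of the quaternion.  The right
multiplication `v q` is the action of `MulOpposite.op q`, in the ring `ℍ[ℝ]ᵐᵒᵖ`.  Both actions
restrict to the same real vector space structure. -/
variable {V : Type*} [NormedAddCommGroup V] [NormedSpace ℝ V]
  [Module ℍ[ℝ]ᵐᵒᵖ V] [IsScalarTower ℝ ℍ[ℝ]ᵐᵒᵖ V]

/-- The operator norm on the bounded right linear operators `B(V) = (V →L[ℍ[ℝ]ᵐᵒᵖ] V)`. -/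
instance instNormedAddCommGroupB : NormedAddCommGroup (V →L[ℍ[ℝ]ᵐᵒᵖ] V) :=
  NormedAddCommGroup.induced (V →L[ℍ[ℝ]ᵐᵒᵖ] V) (V →L[ℝ] V)
    ({ toFun := fun T => T.restrictScalars ℝ
       map_zero' := rfl
       map_add' := fun _ _ => rfl } : (V →L[ℍ[ℝ]ᵐᵒᵖ] V) →+ (V →L[ℝ] V))
    (fun A B h => by
      ext v
      exact DFunLike.congr_fun h v)

theorem norm_restrictScalars (T : V →L[ℍ[ℝ]ᵐᵒᵖ] V) :
    ‖T.restrictScalars ℝ‖ = ‖T‖ := rfl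

instance instNormedSpaceB : NormedSpace ℝ (V →L[ℍ[ℝ]ᵐᵒᵖ] V) where
  norm_smul_le c T := by
    rw [← norm_restrictScalars, ← norm_restrictScalars]
    exact norm_smul_le c (T.restrictScalars ℝ)

/-- `B(V)` is a Banach space, so the Bochner integrals below are the genuine ones. -/
instance instCompleteSpaceB [CompleteSpace V] [IsBoundedSMul ℍ[ℝ]ᵐᵒᵖ V] :
    CompleteSpace (V →L[ℍ[ℝ]ᵐᵒᵖ] V) := by
  let φ : (V →L[ℍ[ℝ]ᵐᵒᵖ] V) → (V →L[ℝ] V) := fun T => T.restrictScalars ℝ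
  have hφ : Isometry φ := Isometry.of_dist_eq fun A B => by
    rw [dist_eq_norm, dist_eq_norm]
    rfl
  have hr : Set.range φ = ⋂ (q : ℍ[ℝ]ᵐᵒᵖ) (v : V), {A : V →L[ℝ] V | A (q • v) = q • A v} := by
    ext A
    simp only [Set.mem_range, Set.mem_iInter, Set.mem_ofPred_eq]
    constructor
    · rintro ⟨T, rfl⟩ q v
      exact T.map_smul q v
    · intro h
      exact ⟨{ toFun := A, map_add' := A.map_add, map_smul' := h, cont := A.cont }, rfl⟩
  refine (completeSpace_iff_isComplete_range hφ.isUniformInducing).2 (IsClosed.isComplete ?_)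
  rw [hr]
  refine isClosed_iInter fun q => isClosed_iInter fun v => isClosed_eq ?_ ?_
  · exact (ContinuousLinearMap.apply ℝ V (q • v)).continuous
  · exact (ContinuousLinearMap.apply ℝ V v).continuous.const_smul q

variable [Module ℍ[ℝ] V] [SMulCommClass ℍ[ℝ]ᵐᵒᵖ ℍ[ℝ] V] [IsScalarTower ℝ ℍ[ℝ] V]
  [IsBoundedSMul ℍ[ℝ] V]

/-- The operator `aℐ : v ↦ a v` of left multiplication by `a`.  In terms of it the left and right
multiplications of an operator by a quaternion, `(aT)(v) = a T(v)` and `(Ta)(v) = T(a v)`, are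
`leftMul a * T` and `T * leftMul a`, where `*` is composition. -/
def leftMul (a : ℍ[ℝ]) : V →L[ℍ[ℝ]ᵐᵒᵖ] V := a • (1 : V →L[ℍ[ℝ]ᵐᵒᵖ] V)

/-- The operator `T² - 2 Re[s] T + |s|² ℐ`. -/
def sPoly (s : ℍ[ℝ]) (T : V →L[ℍ[ℝ]ᵐᵒᵖ] V) : V →L[ℍ[ℝ]ᵐᵒᵖ] V :=
  T ^ 2 - (2 * s.re) • T + (‖s‖ ^ 2) • (1 : V →L[ℍ[ℝ]ᵐᵒᵖ] V)

/-- The `S`-spectrum: the quaternions `s` for which `T² - 2 Re[s] T + |s|² ℐ` has no two-sided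
inverse in `B(V)`. -/
def sSpectrum (T : V →L[ℍ[ℝ]ᵐᵒᵖ] V) : Set ℍ[ℝ] := {s | ¬ IsUnit (sPoly s T)}

/-- The `S`-resolvent operator `S⁻¹(s,T) = -(T² - 2 Re[s] T + |s|² ℐ)⁻¹ (T - s̄ ℐ)`, meant for `s`
outside the `S`-spectrum. -/
def sResolvent (s : ℍ[ℝ]) (T : V →L[ℍ[ℝ]ᵐᵒᵖ] V) : V →L[ℍ[ℝ]ᵐᵒᵖ] V :=
  -(Ring.inverse (sPoly s T) * (T - leftMul (star s)))

end Operators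

/-- The sphere `𝕊` of purely imaginary unit quaternions. -/
def unitSphere : Set ℍ[ℝ] := {q | q.re = 0 ∧ ‖q‖ = 1}

/-- The map `x + i y ↦ x + I y`; for `I ∈ 𝕊` it is an isometric isomorphism of `ℂ` onto the
plane `L_I`. -/
def slice (I : ℍ[ℝ]) (z : ℂ) : ℍ[ℝ] := (z.re : ℍ[ℝ]) + I * (z.im : ℍ[ℝ])

/-- The plane `L_I = ℝ + I ℝ`. -/
def slicePlane (I : ℍ[ℝ]) : Set ℍ[ℝ] := Set.range (slice I)

/-- The winding number about `z` of a closed rectifiable curve `γ : [0,1] → ℂ`. -/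
def windingNumber (γ : ℝ → ℂ) (z : ℂ) : ℂ :=
  (2 * Real.pi * Complex.I)⁻¹ * ∫ t in (0 : ℝ)..1, deriv γ t / (γ t - z)

/-- The closed rectifiable curves `γ 0, …, γ (n-1)`, parametrized on `[0,1]` by Lipschitz maps
(for instance piecewise `C¹` maps), form the positively oriented boundary of `D ⊆ ℂ`: together
they trace out `∂D`, they wind once around each point of `D`, and do not wind around the points
outside the closure of `D`. -/
structure IsPositiveBoundary (D : Set ℂ) {n : ℕ} (γ : Fin n → ℝ → ℂ) : Prop where
  lipschitz : ∀ k, ∃ K : NNReal, LipschitzOnWith K (γ k) (Set.Icc 0 1)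
  closed : ∀ k, γ k 0 = γ k 1
  trace : ⋃ k, γ k '' Set.Icc 0 1 = frontier D
  winding_inside : ∀ z ∈ D, ∑ k, windingNumber (γ k) z = 1
  winding_outside : ∀ z ∉ closure D, ∑ k, windingNumber (γ k) z = 0

section Integral

variable {V : Type*} [NormedAddCommGroup V] [NormedSpace ℝ V]
  [Module ℍ[ℝ] V] [Module ℍ[ℝ]ᵐᵒᵖ V] [SMulCommClass ℍ[ℝ]ᵐᵒᵖ ℍ[ℝ] V]
  [IsScalarTower ℝ ℍ[ℝ] V] [IsScalarTower ℝ ℍ[ℝ]ᵐᵒᵖ V]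
  [IsBoundedSMul ℍ[ℝ] V] [IsBoundedSMul ℍ[ℝ]ᵐᵒᵖ V]

/-- The integrand of `∫ S⁻¹(s,T) ds_I f(s)` along the curve `s = γ(t)` in `L_I ≅ ℂ`, where
`ds_I = -I ds = -I γ'(t) dt`. -/
def sIntegrand (I : ℍ[ℝ]) (T : V →L[ℍ[ℝ]ᵐᵒᵖ] V) (f : ℍ[ℝ] → ℍ[ℝ]) (γ : ℝ → ℂ) (t : ℝ) :
    V →L[ℍ[ℝ]ᵐᵒᵖ] V :=
  sResolvent (slice I (γ t)) T *
    leftMul (-I * slice I (deriv γ t) * f (slice I (γ t)))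

/-- The integral `∫ S⁻¹(s,T) ds_I f(s)` over the curves `γ 0, …, γ (n-1)` in `L_I ≅ ℂ`, a Bochner
integral in `B(V)` with its operator norm. -/
def sIntegral (I : ℍ[ℝ]) (T : V →L[ℍ[ℝ]ᵐᵒᵖ] V) (f : ℍ[ℝ] → ℍ[ℝ]) {n : ℕ}
    (γ : Fin n → ℝ → ℂ) : V →L[ℍ[ℝ]ᵐᵒᵖ] V :=
  ∑ k, ∫ t in (0 : ℝ)..1, sIntegrand I T f (γ k) t

end Integral

end QuatFC

end

open scoped Quaternion

noncomputable section

namespace QuatFC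

/-! ### Calculus along Lipschitz curves -/

section LipschitzCurves

open MeasureTheory Set

variable {γ : ℝ → ℂ} {K : NNReal}

/-! The quaternionic formula reduces to the complex Riesz–Dunford calculus. Right multiplication by
`L_I ≅ ℂ` makes `B(V)` a complex Banach space, and composition with `T` on the left is a bounded
ℂ-linear operator `L_T` on it. Since `s + s̄` and `s̄ s` are real, left composition with `T² - 2
Re[s] T + |s|²` factors as `(z - L_T)(z̄ - L_T)` (`mulLeftHom_sPoly`). So the complex spectrum of
`L_T` lies in the slice of the `S`-spectrum, and off that slice `(z - L_T)⁻¹` sends `1` to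
`S⁻¹(s,T)` (`resolvent_mulLeftHom_apply_one`).

In a complex Banach algebra `∑ ∮ z^m (z - a)⁻¹ dz = 2πi a^m` (`sum_integral_pow_smul_resolvent`).
The case `m = 0` needs only winding numbers: a Cauchy integral and a multiple of the resolvent glue
to an entire function vanishing at infinity, as in Dixon's proof of Cauchy's theorem. For `a = L_T`,
evaluating at `1` and multiplying on the right by `-I a` gives the monomials; polynomials follow by
additivity. -/

theorem norm_deriv_le_of_lipschitzOn_Icc (hγ : LipschitzOnWith K γ (Icc 0 1)) {t : ℝ}
    (ht : t ∈ Ioo (0 : ℝ) 1) : ‖deriv γ t‖ ≤ K :=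
  norm_deriv_le_of_lipschitzOn (Icc_mem_nhds ht.1 ht.2) hγ

theorem ae_mem_Ioo_of_mem_uIoc : ∀ᵐ t : ℝ, t ∈ uIoc (0 : ℝ) 1 → t ∈ Ioo (0 : ℝ) 1 := by
  filter_upwards [compl_mem_ae_iff.2 (measure_singleton (1 : ℝ))] with t ht h
  rw [uIoc_of_le zero_le_one] at h
  exact ⟨h.1, lt_of_le_of_ne h.2 ht⟩

theorem intervalIntegrable_deriv_of_lipschitzOn (hγ : LipschitzOnWith K γ (Icc 0 1)) :
    IntervalIntegrable (deriv γ) volume 0 1 := by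
  refine (intervalIntegrable_const (c := (K : ℝ))).mono_fun
    (measurable_deriv γ).aestronglyMeasurable ?_
  rw [Filter.EventuallyLE, ae_restrict_iff' measurableSet_uIoc]
  filter_upwards [ae_mem_Ioo_of_mem_uIoc] with t ht h
  simpa using norm_deriv_le_of_lipschitzOn_Icc hγ (ht h)

theorem intervalIntegrable_deriv_smul {E : Type*} [NormedAddCommGroup E] [NormedSpace ℂ E]
    (hγ : LipschitzOnWith K γ (Icc 0 1)) {g : ℝ → E} (hg : ContinuousOn g (Icc 0 1)) :
    IntervalIntegrable (fun t => deriv γ t • g t) volume 0 1 := by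
  refine (intervalIntegrable_deriv_of_lipschitzOn hγ).smul_continuousOn ?_
  rwa [uIcc_of_le zero_le_one]

theorem ae_differentiableAt_of_lipschitzOn (hγ : LipschitzOnWith K γ (Icc 0 1)) :
    ∀ᵐ t : ℝ, t ∈ uIoc (0 : ℝ) 1 → DifferentiableAt ℝ γ t := by
  filter_upwards [hγ.ae_differentiableWithinAt_of_mem_real, ae_mem_Ioo_of_mem_uIoc] with t h1 h2 ht
  have := h2 ht
  exact (h1 (Ioo_subset_Icc_self this)).differentiableAt (Icc_mem_nhds this.1 this.2)

/-- The trace is compact, and `z ^ m` is `C¹`, hence Lipschitz on a ball containing it. -/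
theorem lipschitzOn_pow (hγ : LipschitzOnWith K γ (Icc 0 1)) (m : ℕ) :
    ∃ K' : NNReal, LipschitzOnWith K' (fun t => γ t ^ m) (Icc 0 1) := by
  obtain ⟨R, hR⟩ :=
    (isCompact_Icc.image_of_continuousOn hγ.continuousOn).isBounded.subset_closedBall 0
  obtain ⟨C, hC⟩ := (contDiff_id.pow m : ContDiff ℝ 1 fun z : ℂ => z ^ m).contDiffOn
    |>.exists_lipschitzOnWith (s := Metric.closedBall (0 : ℂ) R) one_ne_zero
      (convex_closedBall _ _) (isCompact_closedBall _ _)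
  exact ⟨C * K, hC.comp hγ fun t ht => hR (mem_image_of_mem _ ht)⟩

theorem integral_deriv_of_lipschitzOn (hγ : LipschitzOnWith K γ (Icc 0 1)) :
    ∫ t in (0 : ℝ)..1, deriv γ t = γ 1 - γ 0 := by
  have hi := intervalIntegrable_deriv_of_lipschitzOn hγ
  -- Real functionals reduce the claim to the fundamental theorem for real absolutely continuous
  -- functions; real and imaginary parts suffice.
  have key : ∀ (L : ℂ →L[ℝ] ℝ), L (∫ t in (0 : ℝ)..1, deriv γ t) = L (γ 1 - γ 0) := by
    intro L
    have hL : LipschitzOnWith (‖L‖₊ * K) (fun t => L (γ t)) (uIcc 0 1) := by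
      rw [uIcc_of_le zero_le_one]
      exact L.lipschitz.comp_lipschitzOnWith hγ
    rw [← L.intervalIntegral_comp_comm hi, map_sub,
      ← hL.absolutelyContinuousOnInterval.integral_deriv_eq_sub]
    refine intervalIntegral.integral_congr_ae ?_
    filter_upwards [ae_differentiableAt_of_lipschitzOn hγ] with t h ht
    exact (L.hasFDerivAt.comp_hasDerivAt t (h ht).hasDerivAt).deriv.symm
  exact Complex.ext (key Complex.reCLM) (key Complex.imCLM)

theorem integral_deriv_mul_pow_eq_zero (hγ : LipschitzOnWith K γ (Icc 0 1)) (hc : γ 0 = γ 1)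
    (m : ℕ) : ∫ t in (0 : ℝ)..1, deriv γ t * γ t ^ m = 0 := by
  obtain ⟨K', hK'⟩ := lipschitzOn_pow hγ (m + 1)
  have h := integral_deriv_of_lipschitzOn hK'
  have h2 : ∫ t in (0 : ℝ)..1, deriv (fun t => γ t ^ (m + 1)) t =
      ∫ t in (0 : ℝ)..1, ((m : ℂ) + 1) * (deriv γ t * γ t ^ m) := by
    refine intervalIntegral.integral_congr_ae ?_
    filter_upwards [ae_differentiableAt_of_lipschitzOn hγ] with t h ht
    rw [((h ht).hasDerivAt.fun_pow (m + 1)).deriv]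
    push_cast
    ring
  rw [h2, intervalIntegral.integral_const_mul, hc, sub_self] at h
  exact (mul_eq_zero.1 h).resolve_left (by exact_mod_cast m.succ_ne_zero)

/-- The Cauchy integral of a continuous function on a closed curve is holomorphic off the curve. -/
theorem differentiableAt_cauchyIntegral {E : Type*} [NormedAddCommGroup E] [NormedSpace ℂ E]
    (hγ : LipschitzOnWith K γ (Icc 0 1)) {g : ℝ → E}
    (hg : ContinuousOn g (Icc 0 1)) {z₀ : ℂ} (hz₀ : z₀ ∉ γ '' Icc 0 1) :
    DifferentiableAt ℂ (fun z => ∫ t in (0 : ℝ)..1, deriv γ t • (γ t - z)⁻¹ • g t) z₀ := by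
  have hcl : IsClosed (γ '' Icc 0 1) :=
    (isCompact_Icc.image_of_continuousOn hγ.continuousOn).isClosed
  obtain ⟨r, hr, hball⟩ := Metric.isOpen_iff.1 hcl.isOpen_compl z₀ hz₀
  -- The curve misses the ball of radius `r`, so halving the radius bounds `(γ t - z)⁻¹` uniformly,
  -- which dominates the derivative under the integral.
  have hsep : ∀ t ∈ Icc (0 : ℝ) 1, ∀ z ∈ Metric.ball z₀ (r / 2), r / 2 ≤ ‖γ t - z‖ := by
    intro t ht z hz
    by_contra! h
    refine hball (a := γ t) ?_ (mem_image_of_mem _ ht)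
    rw [Metric.mem_ball] at hz ⊢
    rw [← dist_eq_norm] at h
    linarith [dist_triangle (γ t) z z₀]
  have hne : ∀ z ∈ Metric.ball z₀ (r / 2), ∀ t ∈ Icc (0 : ℝ) 1, γ t - z ≠ 0 := fun z hz t ht =>
    norm_pos_iff.1 ((half_pos hr).trans_le (hsep t ht z hz))
  have hcont : ∀ z ∈ Metric.ball z₀ (r / 2), ContinuousOn (fun t => (γ t - z)⁻¹ • g t) (Icc 0 1) :=
    fun z hz => ((hγ.continuousOn.sub continuousOn_const).inv₀ (hne z hz)).smul hg
  have hnhds : Metric.ball z₀ (r / 2) ∈ nhds z₀ := Metric.ball_mem_nhds _ (half_pos hr)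
  have hmem : z₀ ∈ Metric.ball z₀ (r / 2) := Metric.mem_ball_self (half_pos hr)
  obtain ⟨M, hM⟩ := isCompact_Icc.exists_bound_of_continuousOn hg
  have hsub : uIoc (0 : ℝ) 1 ⊆ Icc 0 1 := by
    rw [uIoc_of_le zero_le_one]; exact Ioc_subset_Icc_self
  refine (intervalIntegral.hasDerivAt_integral_of_dominated_loc_of_deriv_le (μ := volume)
    (F' := fun z t => deriv γ t • ((γ t - z)⁻¹ ^ 2) • g t)
    (bound := fun _ => K * ((r / 2)⁻¹ ^ 2 * M)) hnhds ?_ ?_ ?_ ?_ ?_ ?_).2.differentiableAt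
  · filter_upwards [hnhds] with z hz
    have := (intervalIntegrable_deriv_smul hγ (hcont z hz)).aestronglyMeasurable
    rwa [uIoc_of_le zero_le_one]
  · exact intervalIntegrable_deriv_smul hγ (hcont z₀ hmem)
  · have := (intervalIntegrable_deriv_smul hγ (g := fun t => ((γ t - z₀)⁻¹ ^ 2) • g t)
      ((((hγ.continuousOn.sub continuousOn_const).inv₀ (hne z₀ hmem)).pow 2).smul
        hg)).aestronglyMeasurable
    rwa [uIoc_of_le zero_le_one]
  · filter_upwards [ae_mem_Ioo_of_mem_uIoc] with t ht h z hz
    rw [norm_smul, norm_smul, norm_pow, norm_inv]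
    gcongr
    · exact norm_deriv_le_of_lipschitzOn_Icc hγ (ht h)
    · exact hsep t (hsub h) z hz
    · exact hM t (hsub h)
  · exact intervalIntegrable_const
  · refine Filter.Eventually.of_forall fun t ht z hz => ?_
    have h1 : HasDerivAt (fun z => (γ t - z)⁻¹) ((γ t - z)⁻¹ ^ 2) z := by
      simpa using ((hasDerivAt_id z).const_sub (γ t)).fun_inv (hne z hz t (hsub ht))
    exact (h1.smul_const (g t)).const_smul (deriv γ t)

end LipschitzCurves

/-! ### Riesz–Dunford formula for powers in a complex Banach algebra -/

section BanachAlgebra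

open MeasureTheory Set Filter

variable {A : Type*} [NormedRing A] [NormedAlgebra ℂ A]

theorem continuousOn_resolvent_comp [CompleteSpace A] {a : A} {γ : ℝ → ℂ} {s : Set ℝ}
    (hγ : ContinuousOn γ s) (h : ∀ t ∈ s, γ t ∈ resolventSet ℂ a) :
    ContinuousOn (fun t => resolvent a (γ t)) s := by
  have : ContinuousOn (resolvent a : ℂ → A) (resolventSet ℂ a) := fun z hz =>
    (spectrum.hasDerivAt_resolvent_const_left hz).continuousAt.continuousWithinAt
  exact this.comp hγ h

theorem resolvent_sub_resolvent {a : A} {z w : ℂ} (hz : z ∈ resolventSet ℂ a)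
    (hw : w ∈ resolventSet ℂ a) :
    resolvent a w - resolvent a z = -((w - z) • (resolvent a w * resolvent a z)) := by
  rw [spectrum.resolvent_eq hz, spectrum.resolvent_eq hw]
  have h : (w - z) • (1 : A) = hw.unit - hz.unit := by
    simp [Algebra.algebraMap_eq_smul_one, sub_smul]
  calc _ = -((↑hw.unit⁻¹ : A) * ((hw.unit : A) - hz.unit) * ↑hz.unit⁻¹) := by
        rw [mul_sub, sub_mul, Units.inv_mul, one_mul, mul_assoc, Units.mul_inv, mul_one, neg_sub]
    _ = _ := by rw [← h]; simp

theorem smul_resolvent {a : A} {z : ℂ} (hz : z ∈ resolventSet ℂ a) :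
    z • resolvent a z = 1 + a * resolvent a z := by
  have h : (algebraMap ℂ A z - a) * resolvent a z = 1 := by
    rw [spectrum.resolvent_eq hz]; exact hz.mul_val_inv
  rw [sub_mul, ← Algebra.smul_def] at h
  rw [← h]; abel

variable {D : Set ℂ} {n : ℕ} {γ : Fin n → ℝ → ℂ}

theorem IsPositiveBoundary.continuousOn (hγ : IsPositiveBoundary D γ) (k : Fin n) :
    ContinuousOn (γ k) (Icc 0 1) :=
  (hγ.lipschitz k).choose_spec.continuousOn

theorem IsPositiveBoundary.notMem (hγ : IsPositiveBoundary D γ) (hD : IsOpen D) (k : Fin n)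
    {t : ℝ} (ht : t ∈ Icc (0 : ℝ) 1) : γ k t ∉ D := by
  have h : γ k t ∈ frontier D := hγ.trace ▸ mem_iUnion.2 ⟨k, mem_image_of_mem _ ht⟩
  rw [hD.frontier_eq] at h
  exact h.2

theorem IsPositiveBoundary.mem_resolventSet (hγ : IsPositiveBoundary D γ) (hD : IsOpen D) {a : A}
    (ha : spectrum ℂ a ⊆ D) (k : Fin n) {t : ℝ} (ht : t ∈ Icc (0 : ℝ) 1) :
    γ k t ∈ resolventSet ℂ a := by
  by_contra h
  exact hγ.notMem hD k ht (ha h)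

theorem IsPositiveBoundary.intervalIntegrable_resolvent [CompleteSpace A]
    (hγ : IsPositiveBoundary D γ) (hD : IsOpen D) {a : A} (ha : spectrum ℂ a ⊆ D) (m : ℕ)
    (k : Fin n) :
    IntervalIntegrable (fun t => (deriv (γ k) t * γ k t ^ m) • resolvent a (γ k t))
      volume 0 1 := by
  obtain ⟨K, hK⟩ := hγ.lipschitz k
  simp_rw [mul_smul]
  exact intervalIntegrable_deriv_smul hK ((hK.continuousOn.pow m).smul
    (continuousOn_resolvent_comp hK.continuousOn fun t ht => hγ.mem_resolventSet hD ha k ht))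

/-- The sum of the Cauchy integrals of the resolvent, at a point `z` of the resolvent set that lies
in the region. -/
theorem sum_cauchyIntegral_resolvent [CompleteSpace A] (hγ : IsPositiveBoundary D γ)
    (hD : IsOpen D) {a : A} (ha : spectrum ℂ a ⊆ D) {z : ℂ} (hzD : z ∈ D)
    (hz : z ∈ resolventSet ℂ a) :
    ∑ k, ∫ t in (0 : ℝ)..1, deriv (γ k) t • (γ k t - z)⁻¹ • resolvent a (γ k t) =
      ((2 * Real.pi * Complex.I : ℂ) • (1 : A) -
        ∑ k, ∫ t in (0 : ℝ)..1, deriv (γ k) t • resolvent a (γ k t)) * resolvent a z := by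
  -- Winding number one lets `2πi` be replaced by `∑ ∫ γ' / (γ - z)`, so the identity can be checked
  -- under each integral.
  have hw := hγ.winding_inside z hzD
  simp only [windingNumber, ← Finset.mul_sum] at hw
  rw [inv_mul_eq_one₀ (by simp [Real.pi_ne_zero])] at hw
  rw [hw, Finset.sum_smul, ← Finset.sum_sub_distrib, Finset.sum_mul]
  refine Finset.sum_congr rfl fun k _ => ?_
  obtain ⟨K, hK⟩ := hγ.lipschitz k
  have hne : ∀ t ∈ Icc (0 : ℝ) 1, γ k t - z ≠ 0 := fun t ht h =>
    hγ.notMem hD k ht (sub_eq_zero.1 h ▸ hzD)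
  have hR : ContinuousOn (fun t => resolvent a (γ k t)) (Icc 0 1) :=
    continuousOn_resolvent_comp hK.continuousOn fun t ht => hγ.mem_resolventSet hD ha k ht
  have hinv : ContinuousOn (fun t => (γ k t - z)⁻¹) (Icc 0 1) :=
    (hK.continuousOn.sub continuousOn_const).inv₀ hne
  have hi1 := intervalIntegrable_deriv_smul hK hR
  have hi2 := intervalIntegrable_deriv_smul hK (g := fun t => (γ k t - z)⁻¹ • (1 : A))
    (hinv.smul continuousOn_const)
  have h1 : (∫ t in (0 : ℝ)..1, deriv (γ k) t / (γ k t - z)) • (1 : A) =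
      ∫ t in (0 : ℝ)..1, deriv (γ k) t • (γ k t - z)⁻¹ • (1 : A) := by
    rw [← intervalIntegral.integral_smul_const]
    simp_rw [div_eq_mul_inv, mul_smul]
  rw [h1, ← intervalIntegral.integral_sub hi2 hi1]
  have h2 := ((ContinuousLinearMap.mul ℂ A).flip (resolvent a z)).intervalIntegral_comp_comm
    (hi2.sub hi1)
  simp only [ContinuousLinearMap.flip_apply, ContinuousLinearMap.mul_apply'] at h2
  rw [← h2]
  refine intervalIntegral.integral_congr fun t ht => ?_
  rw [uIcc_of_le zero_le_one] at ht
  -- With `w = γ k t` and `R` the resolvent, dividing the resolvent identity by `w - z` gives `(w -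
  -- z)⁻¹ R(w) = ((w - z)⁻¹ - R(w)) R(z)`.
  have h3 := resolvent_sub_resolvent hz (hγ.mem_resolventSet hD ha k ht)
  rw [← smul_sub, smul_mul_assoc, sub_mul, smul_mul_assoc, one_mul]
  congr 1
  rw [inv_smul_eq_iff₀ (hne t ht), smul_sub, smul_inv_smul₀ (hne t ht), sub_eq_add_neg, ← h3]
  abel

/-- **Riesz**: the resolvent integrates to `2πi` over the boundary of a region that contains the
spectrum. -/
theorem sum_integral_resolvent [CompleteSpace A] (hγ : IsPositiveBoundary D γ)
    (hD : IsOpen D) {a : A} (ha : spectrum ℂ a ⊆ D) :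
    ∑ k, ∫ t in (0 : ℝ)..1, deriv (γ k) t • resolvent a (γ k t) =
      (2 * Real.pi * Complex.I : ℂ) • (1 : A) := by
  classical
  set Q : A := (2 * Real.pi * Complex.I : ℂ) • (1 : A) -
    ∑ k, ∫ t in (0 : ℝ)..1, deriv (γ k) t • resolvent a (γ k t) with hQ
  set C : ℂ → A := fun z =>
    ∑ k, ∫ t in (0 : ℝ)..1, deriv (γ k) t • (γ k t - z)⁻¹ • resolvent a (γ k t) with hC
  -- `D` and the resolvent set are open and cover the plane, and the two formulas agree on their
  -- overlap. So `E` is entire and, by Liouville, zero; invertibility of the resolvent then forces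
  -- `Q = 0`.
  let E : ℂ → A := fun z => if z ∈ D then C z else Q * resolvent a z
  have hE1 : ∀ z ∈ D, E z = C z := fun z hz => if_pos hz
  have hE2 : ∀ z ∈ resolventSet ℂ a, E z = Q * resolvent a z := by
    intro z hz
    by_cases hzD : z ∈ D
    · rw [hE1 z hzD]
      exact sum_cauchyIntegral_resolvent hγ hD ha hzD hz
    · exact if_neg hzD
  have hdiff : Differentiable ℂ E := by
    intro z
    by_cases hz : z ∈ D
    · have hCz : DifferentiableAt ℂ C z := by
        refine DifferentiableAt.fun_sum fun k _ => ?_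
        obtain ⟨K, hK⟩ := hγ.lipschitz k
        refine differentiableAt_cauchyIntegral hK (continuousOn_resolvent_comp hK.continuousOn
          fun t ht => hγ.mem_resolventSet hD ha k ht) ?_
        rintro ⟨t, ht, rfl⟩
        exact hγ.notMem hD k ht hz
      exact hCz.congr_of_eventuallyEq (eventually_of_mem (hD.mem_nhds hz) hE1)
    · have hzr : z ∈ resolventSet ℂ a := by
        by_contra h
        exact hz (ha h)
      exact ((spectrum.hasDerivAt_resolvent_const_left hzr).differentiableAt.const_mul
        Q).congr_of_eventuallyEq
          (eventually_of_mem ((spectrum.isOpen_resolventSet a).mem_nhds hzr) hE2)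
  have hbig : ∀ᶠ z in Bornology.cobounded ℂ, z ∈ resolventSet ℂ a := by
    filter_upwards [spectrum.eventually_isUnit_resolvent (𝕜 := ℂ) a] with z hz
    exact spectrum.isUnit_resolvent.2 hz
  have hlim : Tendsto E (Bornology.cobounded ℂ) (nhds 0) := by
    have h := (spectrum.resolvent_tendsto_cobounded a (𝕜 := ℂ)).const_mul Q
    rw [mul_zero] at h
    exact h.congr' (hbig.mono fun z hz => (hE2 z hz).symm)
  obtain ⟨z, hz⟩ := hbig.exists
  have h0 : Q * resolvent a z = 0 := by
    rw [← hE2 z hz]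
    exact hdiff.apply_eq_of_tendsto_cocompact z
      (by rwa [Metric.cobounded_eq_cocompact] at hlim)
  rw [(spectrum.isUnit_resolvent.1 hz).mul_left_eq_zero] at h0
  exact (sub_eq_zero.1 h0).symm

/-- Induction via `z R(z) = 1 + a R(z)`: the term `z ^ m • 1` has a primitive and integrates to zero
over closed curves. -/
theorem sum_integral_pow_smul_resolvent [CompleteSpace A] (hγ : IsPositiveBoundary D γ)
    (hD : IsOpen D) {a : A} (ha : spectrum ℂ a ⊆ D) (m : ℕ) :
    ∑ k, ∫ t in (0 : ℝ)..1, (deriv (γ k) t * γ k t ^ m) • resolvent a (γ k t) =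
      (2 * Real.pi * Complex.I : ℂ) • a ^ m := by
  induction m with
  | zero => simpa using sum_integral_resolvent hγ hD ha
  | succ m ih =>
    rw [pow_succ', ← mul_smul_comm, ← ih, Finset.mul_sum]
    refine Finset.sum_congr rfl fun k _ => ?_
    obtain ⟨K, hK⟩ := hγ.lipschitz k
    have hi := hγ.intervalIntegrable_resolvent hD ha m k
    have hp : IntervalIntegrable (fun t => deriv (γ k) t * γ k t ^ m) volume 0 1 :=
      intervalIntegrable_deriv_smul hK (hK.continuousOn.pow m)
    have h1 := (ContinuousLinearMap.mul ℂ A a).intervalIntegral_comp_comm hi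
    simp only [ContinuousLinearMap.mul_apply'] at h1
    have h2 : ∫ t in (0 : ℝ)..1, (deriv (γ k) t * γ k t ^ m) • (1 : A) = 0 := by
      rw [intervalIntegral.integral_smul_const,
        integral_deriv_mul_pow_eq_zero hK (hγ.closed k), zero_smul]
    rw [← h1, ← zero_add (∫ t in (0 : ℝ)..1, a * _), ← h2,
      ← intervalIntegral.integral_add (hp.smul_continuousOn continuousOn_const)
        (hi.continuousOn_mul continuousOn_const)]
    refine intervalIntegral.integral_congr fun t ht => ?_
    rw [uIcc_of_le zero_le_one] at ht
    rw [pow_succ, ← mul_assoc, mul_smul, smul_resolvent (hγ.mem_resolventSet hD ha k ht), smul_add,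
      mul_smul_comm]

end BanachAlgebra

end QuatFC

end

open scoped Quaternion

noncomputable section

namespace QuatFC

section BanachAlgebra

open MeasureTheory Set

variable {A : Type*} [NormedRing A] [NormedAlgebra ℂ A] [CompleteSpace A]
  {D : Set ℂ} {n : ℕ} {γ : Fin n → ℝ → ℂ}

/-- A continuous additive map is automatically real linear, so it commutes with the integral without
any compatibility between the complex structure of `A` and the real structure of `E`. -/
theorem sum_integral_map_pow_smul_resolvent {E : Type*} [NormedAddCommGroup E] [NormedSpace ℝ E]
    [CompleteSpace E] (hγ : IsPositiveBoundary D γ) (hD : IsOpen D) {a : A}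
    (ha : spectrum ℂ a ⊆ D) (m : ℕ) (φ : A →+ E) (hφ : Continuous φ) :
    (∀ k, IntervalIntegrable
      (fun t => φ ((deriv (γ k) t * γ k t ^ m) • resolvent a (γ k t))) volume 0 1) ∧
    ∑ k, ∫ t in (0 : ℝ)..1, φ ((deriv (γ k) t * γ k t ^ m) • resolvent a (γ k t)) =
      φ ((2 * Real.pi * Complex.I : ℂ) • a ^ m) := by
  let ψ : A →L[ℝ] E := φ.toRealLinearMap hφ
  have hi := fun k => hγ.intervalIntegrable_resolvent hD ha m k
  refine ⟨fun k => ⟨ψ.integrable_comp (hi k).1, ψ.integrable_comp (hi k).2⟩, ?_⟩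
  rw [← sum_integral_pow_smul_resolvent hγ hD ha m, map_sum]
  exact Finset.sum_congr rfl fun k _ => ψ.intervalIntegral_comp_comm (hi k)

end BanachAlgebra

/-! ### Noncommutative ring identities -/

section Ring

variable {R : Type*} [Ring R]

theorem sq_mul_sub_add_eq (t x a b : R) :
    t ^ 2 * x - t * x * (a + b) + x * (b * a) = (x * b - t * x) * a - t * (x * b - t * x) := by
  noncomm_ring

theorem neg_mul_sub_mul_eq {t c : R} (h : t * c = c * t) (a b : R) :
    -(c * (t - b)) * a - t * -(c * (t - b)) = c * ((b - t) * a - t * (b - t)) := by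
  rw [mul_neg t, ← mul_assoc t, h]
  noncomm_ring

end Ring

/-! ### The plane `L_I` as a copy of `ℂ` -/

section Slice

variable {I : ℍ[ℝ]}

theorem mul_self_of_mem_unitSphere (hI : I ∈ unitSphere) : I * I = -1 := by
  have h : star I = -I := by
    ext <;> simp [hI.1]
  have h2 := Quaternion.self_mul_star I
  rw [Quaternion.normSq_eq_norm_mul_self, hI.2, h, mul_neg] at h2
  rw [← neg_eq_iff_eq_neg, h2]
  simp

theorem slice_add (z w : ℂ) : slice I (z + w) = slice I z + slice I w := by
  simp only [slice, Complex.add_re, Complex.add_im, Quaternion.coe_add, mul_add]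
  abel

theorem slice_ofReal (r : ℝ) : slice I r = r := by simp [slice]

theorem slice_one : slice I 1 = 1 := by simp [slice]

theorem slice_zero : slice I 0 = 0 := by simp [slice]

theorem slice_I : slice I Complex.I = I := by simp [slice]

theorem slice_mul (hI : I ∈ unitSphere) (z w : ℂ) :
    slice I (z * w) = slice I z * slice I w := by
  have h : ∀ r s : ℝ, I * (r : ℍ[ℝ]) * (I * (s : ℍ[ℝ])) = -((r * s : ℝ) : ℍ[ℝ]) := by
    intro r s
    rw [mul_assoc, ← mul_assoc (r : ℍ[ℝ]), Quaternion.coe_commutes r I, mul_assoc, ← mul_assoc I,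
      mul_self_of_mem_unitSphere hI]
    simp
  simp only [slice, Complex.mul_re, Complex.mul_im, add_mul, mul_add, h]
  rw [← mul_assoc (z.re : ℍ[ℝ]), Quaternion.coe_commutes z.re I]
  simp only [Quaternion.coe_sub, Quaternion.coe_add, Quaternion.coe_mul, mul_add, mul_assoc]
  abel

theorem slice_pow (hI : I ∈ unitSphere) (z : ℂ) (m : ℕ) : slice I (z ^ m) = slice I z ^ m := by
  induction m with
  | zero => simp [slice_one]
  | succ m ih => rw [pow_succ, pow_succ, slice_mul hI, ih]

theorem slice_re (hI : I ∈ unitSphere) (z : ℂ) : (slice I z).re = z.re := by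
  simp [slice, hI.1]

theorem star_slice (hI : I ∈ unitSphere) (z : ℂ) :
    star (slice I z) = slice I (starRingEnd ℂ z) := by
  have h : star I = -I := by
    ext <;> simp [hI.1]
  simp [slice, h, Quaternion.coe_commutes]

theorem norm_slice (hI : I ∈ unitSphere) (z : ℂ) : ‖slice I z‖ = ‖z‖ := by
  have h : ‖slice I z‖ ^ 2 = ‖z‖ ^ 2 := by
    have h2 := Quaternion.self_mul_star (slice I z)
    rw [star_slice hI, ← slice_mul hI, Complex.mul_conj, slice_ofReal] at h2
    rw [sq, ← Quaternion.normSq_eq_norm_mul_self, ← Complex.normSq_eq_norm_sq]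
    exact (Quaternion.coe_injective h2).symm
  exact (pow_left_inj₀ (norm_nonneg _) (norm_nonneg _) two_ne_zero).1 h

end Slice

/-! ### `B(V)` as a complex Banach space and the `S`-resolvent -/

section Operators

variable {V : Type*} [NormedAddCommGroup V] [NormedSpace ℝ V]
  [Module ℍ[ℝ]ᵐᵒᵖ V] [IsScalarTower ℝ ℍ[ℝ]ᵐᵒᵖ V]

theorem norm_mul_le_of_rightLinear (S T : V →L[ℍ[ℝ]ᵐᵒᵖ] V) : ‖S * T‖ ≤ ‖S‖ * ‖T‖ :=
  (S.restrictScalars ℝ).opNorm_comp_le (T.restrictScalars ℝ)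

variable [Module ℍ[ℝ] V] [SMulCommClass ℍ[ℝ]ᵐᵒᵖ ℍ[ℝ] V] [IsScalarTower ℝ ℍ[ℝ] V]
  [IsBoundedSMul ℍ[ℝ] V]

theorem leftMul_add (a b : ℍ[ℝ]) :
    (leftMul (a + b) : V →L[ℍ[ℝ]ᵐᵒᵖ] V) = leftMul a + leftMul b :=
  add_smul a b _

theorem leftMul_mul (a b : ℍ[ℝ]) :
    (leftMul (a * b) : V →L[ℍ[ℝ]ᵐᵒᵖ] V) = leftMul a * leftMul b := by
  ext v
  exact mul_smul a b v

theorem leftMul_zero : (leftMul 0 : V →L[ℍ[ℝ]ᵐᵒᵖ] V) = 0 := zero_smul _ _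

theorem leftMul_one : (leftMul 1 : V →L[ℍ[ℝ]ᵐᵒᵖ] V) = 1 := one_smul _ _

theorem leftMul_coe (r : ℝ) : (leftMul (r : ℍ[ℝ]) : V →L[ℍ[ℝ]ᵐᵒᵖ] V) = r • 1 := by
  ext v
  exact algebraMap_smul ℍ[ℝ] r v

theorem leftMul_sum {ι : Type*} (s : Finset ι) (a : ι → ℍ[ℝ]) :
    (leftMul (∑ i ∈ s, a i) : V →L[ℍ[ℝ]ᵐᵒᵖ] V) = ∑ i ∈ s, leftMul (a i) :=
  Finset.sum_smul

theorem norm_leftMul_le (a : ℍ[ℝ]) : ‖(leftMul a : V →L[ℍ[ℝ]ᵐᵒᵖ] V)‖ ≤ ‖a‖ :=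
  ((leftMul a : V →L[ℍ[ℝ]ᵐᵒᵖ] V).restrictScalars ℝ).opNorm_le_bound (norm_nonneg a)
    fun v => norm_smul_le a v

variable {I : ℍ[ℝ]}

variable (V) in
/-- The bounded right linear operators as a complex normed space, where `z` acts as right
multiplication by the quaternion of the plane `L_I` that corresponds to `z`. -/
abbrev sliceNormedSpace (hI : I ∈ unitSphere) : NormedSpace ℂ (V →L[ℍ[ℝ]ᵐᵒᵖ] V) where
  smul z X := X * leftMul (slice I z)
  one_smul X := by
    change X * leftMul (slice I 1) = X
    rw [slice_one, leftMul_one, mul_one]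
  mul_smul z w X := by
    change X * leftMul (slice I (z * w)) = X * leftMul (slice I w) * leftMul (slice I z)
    -- Right multiplication reverses products; it is an action here because `L_I` is commutative.
    rw [mul_comm z w, slice_mul hI, leftMul_mul, mul_assoc]
  smul_zero z := zero_mul (leftMul (slice I z))
  smul_add z X Y := add_mul X Y (leftMul (slice I z))
  add_smul z w X := by
    change X * leftMul (slice I (z + w)) = X * leftMul (slice I z) + X * leftMul (slice I w)
    rw [slice_add, leftMul_add, mul_add]
  zero_smul X := by
    change X * leftMul (slice I 0) = 0
    rw [slice_zero, leftMul_zero, mul_zero]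
  norm_smul_le z X := by
    change ‖X * leftMul (slice I z)‖ ≤ ‖z‖ * ‖X‖
    rw [mul_comm, ← norm_slice hI]
    exact (norm_mul_le_of_rightLinear _ _).trans
      (mul_le_mul_of_nonneg_left (norm_leftMul_le _) (norm_nonneg X))

variable (V) in
/-- Composition on the left, as a homomorphism into the complex Banach algebra of the bounded
operators on `B(V)`. -/
def mulLeftHom (hI : I ∈ unitSphere) :
    letI := sliceNormedSpace V hI
    (V →L[ℍ[ℝ]ᵐᵒᵖ] V) →+* ((V →L[ℍ[ℝ]ᵐᵒᵖ] V) →L[ℂ] (V →L[ℍ[ℝ]ᵐᵒᵖ] V)) :=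
  letI := sliceNormedSpace V hI
  { toFun := fun T => LinearMap.mkContinuous
      { toFun := fun X => T * X
        map_add' := mul_add T
        map_smul' := fun z X => (mul_assoc T X (leftMul (slice I z))).symm } ‖T‖
      (norm_mul_le_of_rightLinear T)
    map_one' := ContinuousLinearMap.ext fun X => one_mul X
    map_mul' := fun S T => ContinuousLinearMap.ext fun X => mul_assoc S T X
    map_zero' := ContinuousLinearMap.ext fun X => zero_mul X
    map_add' := fun S T => ContinuousLinearMap.ext fun X => add_mul S T X }

theorem mulLeftHom_apply (hI : I ∈ unitSphere) (T X : V →L[ℍ[ℝ]ᵐᵒᵖ] V) :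
    letI := sliceNormedSpace V hI
    mulLeftHom V hI T X = T * X := rfl

/-- `T` need not commute with `leftMul s`, but the coefficients `s + s̄` and `s̄ s` are real and can
be moved to the right of `X`, where the quadratic factors. -/
theorem sPoly_slice_mul (hI : I ∈ unitSphere) (T X : V →L[ℍ[ℝ]ᵐᵒᵖ] V) (z : ℂ) :
    sPoly (slice I z) T * X = (X * leftMul (star (slice I z)) - T * X) * leftMul (slice I z) -
      T * (X * leftMul (star (slice I z)) - T * X) := by
  have hs : (leftMul (slice I z) : V →L[ℍ[ℝ]ᵐᵒᵖ] V) + leftMul (star (slice I z)) =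
      (2 * z.re) • 1 := by
    rw [star_slice hI, ← leftMul_add, ← slice_add, Complex.add_conj, slice_ofReal, leftMul_coe]
  have hp : (leftMul (star (slice I z)) : V →L[ℍ[ℝ]ᵐᵒᵖ] V) * leftMul (slice I z) =
      (‖z‖ ^ 2) • 1 := by
    rw [star_slice hI, ← leftMul_mul, ← slice_mul hI, mul_comm, Complex.mul_conj, slice_ofReal,
      leftMul_coe, Complex.normSq_eq_norm_sq]
  have h : sPoly (slice I z) T * X = T ^ 2 * X - T * X * ((2 * z.re) • 1) +
      X * ((‖z‖ ^ 2) • 1) := by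
    rw [mul_smul_comm, mul_smul_comm, mul_one, mul_one, sPoly, slice_re hI, norm_slice hI, add_mul,
      smul_mul_assoc, one_mul, ← smul_mul_assoc (2 * z.re)]
    exact congrArg (· + ‖z‖ ^ 2 • X) (sub_mul (T ^ 2) ((2 * z.re) • T) X)
  rw [h, ← hs, ← hp]
  exact sq_mul_sub_add_eq T X _ _

theorem mulLeftHom_sPoly (hI : I ∈ unitSphere) (T : V →L[ℍ[ℝ]ᵐᵒᵖ] V) (z : ℂ) :
    letI := sliceNormedSpace V hI
    mulLeftHom V hI (sPoly (slice I z) T) =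
      (algebraMap ℂ _ z - mulLeftHom V hI T) *
        (algebraMap ℂ _ (starRingEnd ℂ z) - mulLeftHom V hI T) := by
  let := sliceNormedSpace V hI
  refine ContinuousLinearMap.ext fun X => ?_
  change sPoly (slice I z) T * X = (X * leftMul (slice I (starRingEnd ℂ z)) - T * X) *
    leftMul (slice I z) - T * (X * leftMul (slice I (starRingEnd ℂ z)) - T * X)
  rw [← star_slice hI, sPoly_slice_mul hI]

theorem mem_resolventSet_mulLeftHom (hI : I ∈ unitSphere) {T : V →L[ℍ[ℝ]ᵐᵒᵖ] V} {z : ℂ}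
    (hz : slice I z ∉ sSpectrum T) :
    letI := sliceNormedSpace V hI
    z ∈ resolventSet ℂ (mulLeftHom V hI T) := by
  let := sliceNormedSpace V hI
  have h : IsUnit (mulLeftHom V hI (sPoly (slice I z) T)) := (not_not.1 hz).map _
  rw [mulLeftHom_sPoly] at h
  -- The factors for `z` and `z̄` commute, so invertibility of the product passes to each.
  refine ((Commute.isUnit_mul_iff ?_).1 h).1
  exact (Algebra.commute_algebraMap_right _ _).sub_right
    ((Algebra.commute_algebraMap_left _ _).sub_left (Commute.refl _))

/-- The `S`-resolvent equation. -/
theorem sResolvent_mul_leftMul_sub (hI : I ∈ unitSphere) {T : V →L[ℍ[ℝ]ᵐᵒᵖ] V} {z : ℂ}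
    (hz : slice I z ∉ sSpectrum T) :
    sResolvent (slice I z) T * leftMul (slice I z) - T * sResolvent (slice I z) T = 1 := by
  have hu : IsUnit (sPoly (slice I z) T) := not_not.1 hz
  -- `sPoly` is a polynomial in `T` with real coefficients, so `T` also commutes with its inverse.
  have hc : Commute T (sPoly (slice I z) T) := by
    unfold sPoly
    exact (((Commute.refl T).pow_right 2).sub_right ((Commute.refl T).smul_right _)).add_right
      ((Commute.one_right T).smul_right _)
  have h := sPoly_slice_mul hI T 1 z
  rw [mul_one, mul_one, one_mul] at h
  have hinv := Ring.inverse_mul_cancel _ hu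
  nth_rewrite 2 [h] at hinv
  rw [← hinv]
  refine neg_mul_sub_mul_eq ?_ _ _
  obtain ⟨u, hu⟩ := hu
  rw [← hu] at hc ⊢
  rw [Ring.inverse_unit]
  exact hc.units_inv_right

/-- The `S`-resolvent equation says exactly that `z - L_T` maps `S⁻¹(s,T)` to `1`. -/
theorem resolvent_mulLeftHom_apply_one (hI : I ∈ unitSphere) {T : V →L[ℍ[ℝ]ᵐᵒᵖ] V} {z : ℂ}
    (hz : slice I z ∉ sSpectrum T) :
    letI := sliceNormedSpace V hI
    resolvent (mulLeftHom V hI T) z 1 = sResolvent (slice I z) T := by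
  let := sliceNormedSpace V hI
  have hu : IsUnit (algebraMap ℂ _ z - mulLeftHom V hI T) := mem_resolventSet_mulLeftHom hI hz
  have h : (algebraMap ℂ _ z - mulLeftHom V hI T) (sResolvent (slice I z) T) = 1 :=
    sResolvent_mul_leftMul_sub hI hz
  rw [← h]
  exact DFunLike.congr_fun (Ring.inverse_mul_cancel _ hu) (sResolvent (slice I z) T)

end Operators

/-! ### The quaternionic integral formula -/

section Integral

open MeasureTheory Set

variable {V : Type*} [NormedAddCommGroup V] [NormedSpace ℝ V] [CompleteSpace V]
  [Module ℍ[ℝ] V] [Module ℍ[ℝ]ᵐᵒᵖ V] [SMulCommClass ℍ[ℝ]ᵐᵒᵖ ℍ[ℝ] V]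
  [IsScalarTower ℝ ℍ[ℝ] V] [IsScalarTower ℝ ℍ[ℝ]ᵐᵒᵖ V]
  [IsBoundedSMul ℍ[ℝ] V] [IsBoundedSMul ℍ[ℝ]ᵐᵒᵖ V]

theorem intervalIntegrable_and_sIntegral_pow_mul (T : V →L[ℍ[ℝ]ᵐᵒᵖ] V) {I : ℍ[ℝ]}
    (hI : I ∈ unitSphere) {D : Set ℂ} (hD : IsOpen D) (hT : slice I ⁻¹' sSpectrum T ⊆ D)
    {n : ℕ} {γ : Fin n → ℝ → ℂ} (hγ : IsPositiveBoundary D γ) (m : ℕ) (a : ℍ[ℝ]) :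
    (∀ k, IntervalIntegrable (sIntegrand I T (fun s => s ^ m * a) (γ k)) volume 0 1) ∧
    sIntegral I T (fun s => s ^ m * a) γ = (2 * Real.pi) • (T ^ m * leftMul a) := by
  let := sliceNormedSpace V hI
  have hspec : spectrum ℂ (mulLeftHom V hI T) ⊆ D := by
    intro z hz
    refine hT ?_
    by_contra h
    exact hz (mem_resolventSet_mulLeftHom hI h)
  let R : (V →L[ℍ[ℝ]ᵐᵒᵖ] V) →+ (V →L[ℍ[ℝ]ᵐᵒᵖ] V) := AddMonoidHom.mulRight (leftMul (-I * a))
  have hR : Continuous R := AddMonoidHomClass.continuous_of_bound R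
    ‖(leftMul (-I * a) : V →L[ℍ[ℝ]ᵐᵒᵖ] V)‖ fun X => (norm_mul_le_of_rightLinear X _).trans_eq (mul_comm _ _)
  -- Evaluation at `1` recovers the `S`-resolvent; right multiplication by `-I a` supplies the
  -- factor of `ds_I` and the coefficient.
  let φ : ((V →L[ℍ[ℝ]ᵐᵒᵖ] V) →L[ℂ] (V →L[ℍ[ℝ]ᵐᵒᵖ] V)) →+ (V →L[ℍ[ℝ]ᵐᵒᵖ] V) :=
    R.comp (ContinuousLinearMap.apply ℂ (V →L[ℍ[ℝ]ᵐᵒᵖ] V)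
      (1 : V →L[ℍ[ℝ]ᵐᵒᵖ] V) : _ →L[ℂ] _).toLinearMap.toAddMonoidHom
  have hφ : Continuous φ := hR.comp (ContinuousLinearMap.apply ℂ (V →L[ℍ[ℝ]ᵐᵒᵖ] V)
      (1 : V →L[ℍ[ℝ]ᵐᵒᵖ] V)).continuous
  have hφ_apply : ∀ (c : ℂ) (X : (V →L[ℍ[ℝ]ᵐᵒᵖ] V) →L[ℂ] (V →L[ℍ[ℝ]ᵐᵒᵖ] V)),
      φ (c • X) = X 1 * leftMul (slice I c) * leftMul (-I * a) := fun _ _ => rfl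
  have hfun : ∀ k, ∀ t ∈ Icc (0 : ℝ) 1,
      φ ((deriv (γ k) t * γ k t ^ m) • resolvent (mulLeftHom V hI T) (γ k t)) =
        sIntegrand I T (fun s => s ^ m * a) (γ k) t := by
    intro k t ht
    have hs : slice I (γ k t) ∉ sSpectrum T := fun h => hγ.notMem hD k ht (hT h)
    rw [hφ_apply, resolvent_mulLeftHom_apply_one hI hs, sIntegrand, mul_assoc, ← leftMul_mul,
      slice_mul hI, slice_pow hI]
    -- `-I` must pass the elements `γ'` and `γ ^ m` of `L_I` to reach its place in `ds_I`; `a` stays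
    -- rightmost.
    have hcomm : ∀ z, slice I z * I = I * slice I z := by
      intro z
      nth_rewrite 2 3 [← slice_I (I := I)]
      rw [← slice_mul hI, ← slice_mul hI, mul_comm]
    have hc : Commute (slice I (deriv (γ k) t) * slice I (γ k t) ^ m) (-I) :=
      (Commute.mul_left (hcomm _) (Commute.pow_left (hcomm _) m)).neg_right
    rw [← mul_assoc _ (-I), hc.eq]
    simp only [mul_assoc]
  obtain ⟨h1, h2⟩ := sum_integral_map_pow_smul_resolvent hγ hD hspec m φ hφ
  refine ⟨fun k => (h1 k).congr fun t ht => hfun k t ?_, ?_⟩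
  · rw [uIoc_of_le zero_le_one] at ht
    exact Ioc_subset_Icc_self ht
  · have h3 : sIntegral I T (fun s => s ^ m * a) γ = φ ((2 * Real.pi * Complex.I : ℂ) •
        mulLeftHom V hI T ^ m) := by
      rw [← h2]
      refine Finset.sum_congr rfl fun k _ => intervalIntegral.integral_congr fun t ht => ?_
      rw [uIcc_of_le zero_le_one] at ht
      exact (hfun k t ht).symm
    -- The `I` in `2πI` cancels the `-I` of `ds_I`, leaving the real constant `2π`.
    have h4 : slice I (2 * Real.pi * Complex.I) * (-I * a) = ((2 * Real.pi : ℝ) : ℍ[ℝ]) * a := by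
      have : (2 * Real.pi * Complex.I : ℂ) = ((2 * Real.pi : ℝ) : ℂ) * Complex.I := by
        push_cast; rfl
      rw [this, slice_mul hI, slice_ofReal, slice_I, mul_assoc, ← mul_assoc I, mul_neg,
        mul_self_of_mem_unitSphere hI, neg_neg, one_mul]
    rw [h3, hφ_apply, ← map_pow, mulLeftHom_apply, mul_one, mul_assoc, ← leftMul_mul, h4,
      leftMul_mul, leftMul_coe, smul_mul_assoc, one_mul, mul_smul_comm]

theorem sIntegrand_sum {ι : Type*} (s : Finset ι) (I : ℍ[ℝ]) (T : V →L[ℍ[ℝ]ᵐᵒᵖ] V)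
    (f : ι → ℍ[ℝ] → ℍ[ℝ]) (γ : ℝ → ℂ) :
    sIntegrand I T (fun q => ∑ i ∈ s, f i q) γ = ∑ i ∈ s, sIntegrand I T (f i) γ := by
  ext1 t
  simp only [sIntegrand, Finset.sum_apply, Finset.mul_sum, leftMul_sum]

theorem sIntegral_sum {ι : Type*} (s : Finset ι) (I : ℍ[ℝ]) (T : V →L[ℍ[ℝ]ᵐᵒᵖ] V)
    (f : ι → ℍ[ℝ] → ℍ[ℝ]) {n : ℕ} (γ : Fin n → ℝ → ℂ)
    (h : ∀ i ∈ s, ∀ k, IntervalIntegrable (sIntegrand I T (f i) (γ k)) volume 0 1) :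
    sIntegral I T (fun q => ∑ i ∈ s, f i q) γ = ∑ i ∈ s, sIntegral I T (f i) γ := by
  simp only [sIntegral]
  rw [Finset.sum_comm]
  refine Finset.sum_congr rfl fun k _ => ?_
  rw [← intervalIntegral.integral_finsetSum fun i hi => h i hi k, sIntegrand_sum]
  simp only [Finset.sum_apply]

end Integral

end QuatFC

end


theorem mainTheorem4 {V : Type*} [NormedAddCommGroup V] [NormedSpace ℝ V] [CompleteSpace V]
    [Module ℍ[ℝ] V] [Module ℍ[ℝ]ᵐᵒᵖ V] [SMulCommClass ℍ[ℝ]ᵐᵒᵖ ℍ[ℝ] V]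
    [IsScalarTower ℝ ℍ[ℝ] V] [IsScalarTower ℝ ℍ[ℝ]ᵐᵒᵖ V]
    [IsBoundedSMul ℍ[ℝ] V] [IsBoundedSMul ℍ[ℝ]ᵐᵒᵖ V]
    (T : V →L[ℍ[ℝ]ᵐᵒᵖ] V) (I : ℍ[ℝ]) (hI : I ∈ QuatFC.unitSphere)
    (U : Set ℍ[ℝ]) (hUL : U ⊆ QuatFC.slicePlane I)
    (hUopen : IsOpen (QuatFC.slice I ⁻¹' U)) (hUbdd : Bornology.IsBounded U)
    (hU : QuatFC.slicePlane I ∩ QuatFC.sSpectrum T ⊆ U)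
    {n : ℕ} (γ : Fin n → ℝ → ℂ)
    (hγ : QuatFC.IsPositiveBoundary (QuatFC.slice I ⁻¹' U) γ) :
    (∀ (m : ℕ) (a : ℍ[ℝ]),
      (∀ k, IntervalIntegrable (QuatFC.sIntegrand I T (fun s => s ^ m * a) (γ k))
        MeasureTheory.volume 0 1) ∧
      T ^ m * QuatFC.leftMul a =
        (1 / (2 * Real.pi)) • QuatFC.sIntegral I T (fun s => s ^ m * a) γ) ∧
    (∀ (N : ℕ) (a : ℕ → ℍ[ℝ]),
      (∀ k, IntervalIntegrable
        (QuatFC.sIntegrand I T (fun s => ∑ m ∈ Finset.range (N + 1), s ^ m * a m) (γ k))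
        MeasureTheory.volume 0 1) ∧
      ∑ m ∈ Finset.range (N + 1), T ^ m * QuatFC.leftMul (a m) =
        (1 / (2 * Real.pi)) •
          QuatFC.sIntegral I T (fun s => ∑ m ∈ Finset.range (N + 1), s ^ m * a m) γ) := by
  have hT : QuatFC.slice I ⁻¹' QuatFC.sSpectrum T ⊆ QuatFC.slice I ⁻¹' U := fun z hz =>
    hU ⟨Set.mem_range_self z, hz⟩
  have key := QuatFC.intervalIntegrable_and_sIntegral_pow_mul T hI hUopen hT hγ
  have hpow : ∀ (m : ℕ) (a : ℍ[ℝ]), T ^ m * QuatFC.leftMul a =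
      (1 / (2 * Real.pi)) • QuatFC.sIntegral I T (fun s => s ^ m * a) γ := by
    intro m a
    rw [(key m a).2, smul_smul, one_div_mul_cancel (by positivity), one_smul]
  refine ⟨fun m a => ⟨(key m a).1, hpow m a⟩, fun N a => ⟨fun k => ?_, ?_⟩⟩
  · rw [QuatFC.sIntegrand_sum]
    exact IntervalIntegrable.sum _ fun m _ => (key m (a m)).1 k
  · rw [QuatFC.sIntegral_sum _ _ _ (fun m s => s ^ m * a m) _ fun m _ => (key m (a m)).1,
      Finset.smul_sum]
    exact Finset.sum_congr rfl fun m _ => hpow m (a m)
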